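/- Let $V_N=\{0,\dots,N\}$ and let $\mathcal Q_N$ be the set of all birth-and-death Markov kernels $Q$ on $V_N$ (that is, $Q(x,y)\ge 0$, $\sum_y Q(x,y)=1$, and $Q(x,y)=0$ if $|x-y|>1$) such that $$Q(x,y)\in[1/4,3/4]\quad\text{whenever } |x-y|\le 1$$ and such that $Q$ has a reversible measure $\pi$ (that is, $\pi(x)Q(x,y)=\pi(y)Q(y,x)$ for all $x,y$) with $1/4\le (N+1)\pi(x)\le 4$ for all $x\in V_N$. For a sequence $(K_i)_{i\ge1}$ of Markov kernels on a finite set $V$ put $K_{0,0}=I$ and $K_{0,n}=K_1K_2\cdots K_n$. For $c\ge1$, the sequence is $c$-stable with respect to a positive measure $\mu_0$ on $V$ if $c^{-1}\le \mu_n(x)/\mu_0(x)\le c$ for all $n\ge0$ and $x\in V$, where $\mu_n=\mu_0K_{0,n}$. For $\varepsilon\in(0,1)$ its relative-sup merging time is $$T_\infty(\varepsilon)=\inf\Bigl\{n\ge 0:\ \max_{x,y,z\in V}\Bigl|\frac{K_{0,n}(x,z)}{K_{0,n}(y,z)}-1\Bigr|<\varepsilon\Bigr\}\in\{0,1,2,\dots\}\cup\{\infty\},$$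 with the conventions $0/0=1$, $a/0=\infty$ for $a>0$, and $\inf\emptyset=\infty$. Write $\log_+ t=\max\{0,\log t\}$. **Theorem.** For every $c\ge 1$ there is a constant $A=A(c)\in(0,\infty)$, depending only on $c$, such that for every $N$ and every sequence $(K_i)_{i\ge1}$ with $K_i\in\mathcal Q_N$ for all $i$ that is $c$-stable with respect to the uniform measure on $V_N$, $$T_\infty(\varepsilon)\le A\,N^2\,(1+\log_+ 1/\varepsilon)\qquad\text{for all }\varepsilon\in(0,1).$$ -/

import Mathlib

open scoped ENNReal Matrix

namespace Merging

noncomputable section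

/-- `iter K n` is the `n`-step kernel `K_{0,n} = K_1 K_2 ⋯ K_n` of the time-inhomogeneous chain
driven by `(K_i)_{i ≥ 1}`, with `K_{0,0} = I`. The entry `K 0` is never used. -/
def iter {V : Type*} [Fintype V] [DecidableEq V] (K : ℕ → Matrix V V ℝ) : ℕ → Matrix V V ℝ
  | 0 => 1
  | n + 1 => iter K n * K (n + 1)

/-- The quotient `a / b` of nonnegative reals in `[0, ∞]`, with the convention `0 / 0 = 1`
and `a / 0 = ∞` for `a > 0`. -/
def ratio (a b : ℝ) : EReal :=
  if b = 0 then (if a = 0 then 1 else ⊤) else ((a / b : ℝ) : EReal)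

/-- The relative-sup discrepancy at time `n`:
`max_{x,y,z} |K_{0,n}(x,z) / K_{0,n}(y,z) - 1|`, a value in `[0, ∞]`. -/
def relSup {V : Type*} [Fintype V] [DecidableEq V] (K : ℕ → Matrix V V ℝ) (n : ℕ) : ℝ≥0∞ :=
  ⨆ (x : V) (y : V) (z : V), (ratio (iter K n x z) (iter K n y z) - 1).abs

/-- The relative-sup merging time `T_∞(ε)`: the least `n ≥ 0` at which the relative-sup
discrepancy is smaller than `ε`, and `∞` if there is no such `n`. -/
def relSupMergingTime {V : Type*} [Fintype V] [DecidableEq V] (K : ℕ → Matrix V V ℝ) (ε : ℝ) :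
    ℕ∞ :=
  ⨅ (n : ℕ) (_ : relSup K n < ENNReal.ofReal ε), (n : ℕ∞)

/-- The sequence `(K_i)_{i ≥ 1}` is `c`-stable with respect to the positive measure `μ₀`:
`c⁻¹ ≤ μ_n(x) / μ₀(x) ≤ c` for all `n ≥ 0` and all `x`, where `μ_n = μ₀ K_{0,n}`. -/
def IsStable {V : Type*} [Fintype V] [DecidableEq V] (c : ℝ) (K : ℕ → Matrix V V ℝ)
    (μ₀ : V → ℝ) : Prop :=
  (∀ x, 0 < μ₀ x) ∧
    ∀ (n : ℕ) (x : V), c⁻¹ ≤ (μ₀ ᵥ* iter K n) x / μ₀ x ∧ (μ₀ ᵥ* iter K n) x / μ₀ x ≤ c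

/-- The uniform probability measure on a finite set. -/
def uniform (V : Type*) [Fintype V] : V → ℝ := fun _ => 1 / (Fintype.card V : ℝ)

/-- `π` is a reversible measure for the kernel `Q` (detailed balance). -/
def IsReversibleMeasure {V : Type*} (Q : Matrix V V ℝ) (π : V → ℝ) : Prop :=
  (∀ x, 0 ≤ π x) ∧ ∀ x y, π x * Q x y = π y * Q y x

/-- The class of birth-and-death Markov kernels `Q` on `{0, …, N}` with
`Q(x,y) ∈ [1/4, 3/4]` whenever `|x - y| ≤ 1` and with a reversible measure `π` such that
`1/4 ≤ (N+1) π(x) ≤ 4` for all `x`. -/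
def bdClass (N : ℕ) : Set (Matrix (Fin (N + 1)) (Fin (N + 1)) ℝ) :=
  {Q | Q ∈ Matrix.rowStochastic ℝ (Fin (N + 1)) ∧
    (∀ x y : Fin (N + 1), 1 < |(x : ℤ) - (y : ℤ)| → Q x y = 0) ∧
    (∀ x y : Fin (N + 1), |(x : ℤ) - (y : ℤ)| ≤ 1 → Q x y ∈ Set.Icc (1 / 4 : ℝ) (3 / 4)) ∧
    ∃ π : Fin (N + 1) → ℝ, IsReversibleMeasure Q π ∧
      ∀ x, 1 / 4 ≤ ((N : ℝ) + 1) * π x ∧ ((N : ℝ) + 1) * π x ≤ 4}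

end

end Merging

namespace Merging

open Finset

/-! Write $\mu_n=\mu_0K_{0,n}$. The forward densities $K_{0,t}(x,\cdot)/\mu_t$ evolve under the time
reversals of the kernels, the backward densities $K_{n-t,n}(\cdot,z)/\mu_n(z)$ under the kernels
themselves. By stability both evolutions live on measures comparable to uniform, with diagonal and
right-neighbour entries bounded below. In either case the second moment $u=\sum\nu f^2$ of a density
loses at each step at least a multiple of `pathEnergy f / (N+1)` (`energy_dissipation`). While
$u\ge2$, `nash` turns this into a loss of order $u^3/N^2$, so $u\le2$ after order $N^2$ steps
whatever its initial size; then `poincare` makes the variance $u-1$ decay like $e^{-bt}$ with $b$ of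
order $N^{-2}$ (`variance_le_exp`). Splitting $K_{0,2T}$ at time $T$, Cauchy–Schwarz in
$\ell^2(\mu_T)$ makes $K_{0,2T}(x,z)/\mu_{2T}(z)$ uniformly close to 1 (`abs_iter_div_sub_one_le`);
dividing two such quantities gives the merging bound. -/

/-! ### Functional inequalities on the path -/

/-- The Dirichlet form of the path `{0, …, N}`. -/
def pathEnergy {N : ℕ} (f : Fin (N + 1) → ℝ) : ℝ :=
  ∑ i : Fin N, (f i.succ - f i.castSucc) ^ 2

lemma pathEnergy_nonneg {N : ℕ} (f : Fin (N + 1) → ℝ) : 0 ≤ pathEnergy f :=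
  sum_nonneg fun _ _ => sq_nonneg _

lemma abs_sub_zero_le_sum {N : ℕ} (f : Fin (N + 1) → ℝ) (j : Fin (N + 1)) :
    |f j - f 0| ≤ ∑ i : Fin N, |f i.succ - f i.castSucc| := by
  induction N with
  | zero => simp [Fin.fin_one_eq_zero j]
  | succ N ih =>
    rw [Fin.sum_univ_castSucc]
    refine Fin.lastCases ?_ (fun j => ?_) j
    · have h := ih (fun k => f k.castSucc) (Fin.last N)
      simp only [Fin.castSucc_zero, ← Fin.succ_castSucc] at h
      have h2 := abs_sub_le (f (Fin.last (N + 1))) (f (Fin.last N).castSucc) (f 0)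
      rw [Fin.succ_last]
      linarith
    · have h := ih (fun k => f k.castSucc) j
      simp only [Fin.castSucc_zero, ← Fin.succ_castSucc] at h
      have h2 := abs_nonneg (f (Fin.last N).succ - f (Fin.last N).castSucc)
      linarith

lemma sq_sub_zero_le {N : ℕ} (f : Fin (N + 1) → ℝ) (j : Fin (N + 1)) :
    (f j - f 0) ^ 2 ≤ (N : ℝ) * pathEnergy f := by
  have h := abs_sub_zero_le_sum f j
  calc (f j - f 0) ^ 2 = |f j - f 0| ^ 2 := (sq_abs _).symm
    _ ≤ (∑ i : Fin N, |f i.succ - f i.castSucc|) ^ 2 := by gcongr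
    _ ≤ #(univ : Finset (Fin N)) * ∑ i : Fin N, |f i.succ - f i.castSucc| ^ 2 :=
        sq_sum_le_card_mul_sum_sq
    _ = (N : ℝ) * pathEnergy f := by simp [pathEnergy]

/-- Poincaré inequality on the path, for a probability measure. -/
lemma poincare {N : ℕ} (ν f : Fin (N + 1) → ℝ) (hν : ∀ x, 0 ≤ ν x) (hsum : ∑ x, ν x = 1)
    (hf : ∑ x, ν x * f x = 1) :
    ∑ x, ν x * f x ^ 2 - 1 ≤ (N : ℝ) * pathEnergy f := by
  have h1 : ∑ x, ν x * (f x - f 0) ^ 2 ≤ ∑ x, ν x * ((N : ℝ) * pathEnergy f) :=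
    sum_le_sum fun x _ => mul_le_mul_of_nonneg_left (sq_sub_zero_le f x) (hν x)
  rw [← sum_mul, hsum, one_mul] at h1
  have h2 : ∑ x, ν x * (f x - f 0) ^ 2 = ∑ x, ν x * f x ^ 2 - 2 * f 0 + f 0 ^ 2 := by
    have : ∀ x, ν x * (f x - f 0) ^ 2 = ν x * f x ^ 2 - 2 * f 0 * (ν x * f x) + f 0 ^ 2 * ν x :=
      fun x => by ring
    simp only [this, sum_add_distrib, sum_sub_distrib, ← mul_sum, hsum, hf, mul_one]
  -- The second moment about `f 0` is at least the variance.
  nlinarith [sq_nonneg (f 0 - 1)]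

/-- Cauchy–Schwarz after factoring each difference of squares. -/
lemma sq_sum_abs_sub_sq_le {N : ℕ} (f : Fin (N + 1) → ℝ) :
    (∑ i : Fin N, |f i.succ ^ 2 - f i.castSucc ^ 2|) ^ 2 ≤
      4 * pathEnergy f * ∑ x, f x ^ 2 := by
  have h0 : ∀ i : Fin N, |f i.succ ^ 2 - f i.castSucc ^ 2| =
      |f i.succ - f i.castSucc| * |f i.succ + f i.castSucc| := fun i => by
    rw [← abs_mul]; congr 1; ring
  have h1 := sum_mul_sq_le_sq_mul_sq univ (fun i : Fin N => |f i.succ - f i.castSucc|)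
    (fun i : Fin N => |f i.succ + f i.castSucc|)
  simp only [sq_abs] at h1
  have h2 : ∑ i : Fin N, (f i.succ + f i.castSucc) ^ 2 ≤ 4 * ∑ x, f x ^ 2 := by
    calc ∑ i : Fin N, (f i.succ + f i.castSucc) ^ 2
        ≤ ∑ i : Fin N, (2 * f i.succ ^ 2 + 2 * f i.castSucc ^ 2) :=
          sum_le_sum fun i _ => by nlinarith [sq_nonneg (f i.succ - f i.castSucc)]
      _ = 2 * ∑ i : Fin N, f i.succ ^ 2 + 2 * ∑ i : Fin N, f i.castSucc ^ 2 := by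
          rw [sum_add_distrib, mul_sum, mul_sum]
      _ ≤ 4 * ∑ x, f x ^ 2 := by
          have a := Fin.sum_univ_succ (fun x => f x ^ 2)
          have b := Fin.sum_univ_castSucc (fun x => f x ^ 2)
          nlinarith [sq_nonneg (f 0), sq_nonneg (f (Fin.last N))]
  simp only [h0]
  refine h1.trans ?_
  have := mul_le_mul_of_nonneg_left h2 (pathEnergy_nonneg f)
  unfold pathEnergy at *
  linarith

/-- Nash inequality on the path, for densities of large `ℓ²` norm. -/
lemma nash {N : ℕ} {c : ℝ} (hc : 0 < c) (ν f : Fin (N + 1) → ℝ)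
    (hν : ∀ x, 1 / (c * (N + 1)) ≤ ν x) (hsum : ∑ x, ν x = 1)
    (hf0 : ∀ x, 0 ≤ f x) (hf : ∑ x, ν x * f x = 1) (hu : 2 ≤ ∑ x, ν x * f x ^ 2) :
    (∑ x, ν x * f x ^ 2) ^ 3 ≤ 64 * c * (N + 1) * pathEnergy f := by
  have hL : 0 < c * ((N : ℝ) + 1) := by positivity
  have hνpos : ∀ x, 0 < ν x := fun x => lt_of_lt_of_le (by positivity) (hν x)
  set u := ∑ x, ν x * f x ^ 2
  set W := ∑ i : Fin N, |f i.succ ^ 2 - f i.castSucc ^ 2|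
  have hW0 : 0 ≤ W := sum_nonneg fun _ _ => abs_nonneg _
  -- A density of mean 1 is at most 1 somewhere; going from `j` through 0 to any `k` changes `f ^ 2`
  -- by at most `2 * W`.
  obtain ⟨j, hj⟩ : ∃ j, f j ≤ 1 := by
    by_contra! h
    have : ∑ x, ν x < ∑ x, ν x * f x :=
      sum_lt_sum_of_nonempty univ_nonempty fun x _ => by nlinarith [hνpos x, h x]
    linarith
  have hk : ∀ k, f k ≤ Real.sqrt (1 + 2 * W) := fun k => by
    apply Real.le_sqrt_of_sq_le
    have a := (abs_le.mp (abs_sub_zero_le_sum (fun x => f x ^ 2) k)).2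
    have b := (abs_le.mp (abs_sub_zero_le_sum (fun x => f x ^ 2) j)).1
    have : f j ^ 2 ≤ 1 := by nlinarith [hf0 j]
    linarith
  have hu1 : u ≤ Real.sqrt (1 + 2 * W) := by
    calc u ≤ ∑ x, Real.sqrt (1 + 2 * W) * (ν x * f x) := sum_le_sum fun x _ => by
          have := mul_le_mul_of_nonneg_left (hk x) (mul_nonneg (hνpos x).le (hf0 x))
          nlinarith
      _ = Real.sqrt (1 + 2 * W) := by rw [← mul_sum, hf, mul_one]
  have hu2 : u ^ 2 ≤ 1 + 2 * W := (Real.le_sqrt' (by linarith)).mp hu1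
  -- As `u ≥ 2`, the 1 is absorbed: `2 * W ≥ 3`.
  have hu3 : u ^ 2 ≤ 4 * W := by nlinarith
  have hQ : ∑ x, f x ^ 2 ≤ c * (N + 1) * u := by
    rw [mul_sum]
    refine sum_le_sum fun x _ => ?_
    have h1 : 1 ≤ c * (N + 1) * ν x := by
      have := mul_le_mul_of_nonneg_left (hν x) hL.le
      rwa [mul_one_div_cancel hL.ne'] at this
    nlinarith [sq_nonneg (f x)]
  have hW := sq_sum_abs_sub_sq_le f
  have hE := pathEnergy_nonneg f
  have h4 : u * u ^ 3 ≤ u * (64 * c * (N + 1) * pathEnergy f) := by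
    calc u * u ^ 3 = (u ^ 2) ^ 2 := by ring
      _ ≤ (4 * W) ^ 2 := by gcongr
      _ = 16 * W ^ 2 := by ring
      _ ≤ 16 * (4 * pathEnergy f * (c * (N + 1) * u)) := by
          gcongr
          exact hW.trans (by gcongr)
      _ = _ := by ring
  exact le_of_mul_le_mul_left h4 (by linarith)

/-! ### Decay of the second moment -/

/-- One step of a Markov kernel `P` charging the diagonal and the right neighbours dissipates the
path energy. -/
lemma energy_dissipation {N : ℕ} {m δ : ℝ} (hδ : 0 ≤ δ) (hm : 0 ≤ m)
    (P : Matrix (Fin (N + 1)) (Fin (N + 1)) ℝ) (ν ν' f : Fin (N + 1) → ℝ)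
    (hP0 : ∀ x y, 0 ≤ P x y) (hP1 : ∀ x, ∑ y, P x y = 1)
    (hPd : ∀ x, δ ≤ P x x) (hPs : ∀ i : Fin N, δ ≤ P i.castSucc i.succ)
    (hν' : ∀ x, m ≤ ν' x) (hstep : ∀ y, ∑ x, ν' x * P x y = ν y) :
    ∑ x, ν' x * (P *ᵥ f) x ^ 2 + m * (δ / 2) * pathEnergy f ≤ ∑ y, ν y * f y ^ 2 := by
  -- The loss of second moment is the average over `ν'` of the variances of `f` under the rows of
  -- `P`; in row `x` only the terms at `x` and `x + 1` are kept.
  have hvar : ∀ x, ∑ y, P x y * (f y - (P *ᵥ f) x) ^ 2 =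
      ∑ y, P x y * f y ^ 2 - (P *ᵥ f) x ^ 2 := fun x => by
    have e : ∀ y, P x y * (f y - (P *ᵥ f) x) ^ 2 = P x y * f y ^ 2 -
        2 * (P *ᵥ f) x * (P x y * f y) + (P *ᵥ f) x ^ 2 * P x y := fun y => by ring
    have e2 : ∑ y, P x y * f y = (P *ᵥ f) x := rfl
    simp only [e, sum_add_distrib, sum_sub_distrib, ← mul_sum, hP1, e2]
    ring
  have hnn : ∀ x y, 0 ≤ P x y * (f y - (P *ᵥ f) x) ^ 2 := fun x y =>
    mul_nonneg (hP0 x y) (sq_nonneg _)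
  have hloc : ∀ i : Fin N, δ / 2 * (f i.succ - f i.castSucc) ^ 2 ≤
      ∑ y, P i.castSucc y * (f y - (P *ᵥ f) i.castSucc) ^ 2 := fun i => by
    have hne : i.castSucc ≠ i.succ := Fin.castSucc_lt_succ.ne
    have h1 : ∑ y ∈ {i.castSucc, i.succ}, P i.castSucc y * (f y - (P *ᵥ f) i.castSucc) ^ 2 ≤
        ∑ y, P i.castSucc y * (f y - (P *ᵥ f) i.castSucc) ^ 2 :=
      sum_le_sum_of_subset_of_nonneg (subset_univ _) fun y _ _ => hnn _ y
    rw [sum_pair hne] at h1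
    refine le_trans ?_ h1
    set b := (P *ᵥ f) i.castSucc
    have h2 := mul_le_mul_of_nonneg_right (hPd i.castSucc) (sq_nonneg (f i.castSucc - b))
    have h3 := mul_le_mul_of_nonneg_right (hPs i) (sq_nonneg (f i.succ - b))
    nlinarith [mul_nonneg hδ (sq_nonneg (f i.succ + f i.castSucc - 2 * b))]
  have hdrop : m * (δ / 2) * pathEnergy f ≤
      ∑ x, ν' x * ∑ y, P x y * (f y - (P *ᵥ f) x) ^ 2 := by
    rw [Fin.sum_univ_castSucc, pathEnergy, mul_sum]
    have hlast := mul_nonneg (hm.trans (hν' (Fin.last N)))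
      (sum_nonneg fun y (_ : y ∈ univ) => hnn (Fin.last N) y)
    refine le_trans (sum_le_sum fun i _ => ?_) (le_add_of_nonneg_right hlast)
    rw [mul_assoc]
    exact mul_le_mul (hν' _) (hloc i) (by positivity) (hm.trans (hν' _))
  have hswap : ∑ x, ν' x * ∑ y, P x y * f y ^ 2 = ∑ y, ν y * f y ^ 2 := by
    simp only [mul_sum, ← hstep, sum_mul]
    rw [sum_comm]
    simp only [mul_assoc]
  simp only [hvar, mul_sub, sum_sub_distrib, hswap] at hdrop
  linarith

/-- A positive sequence losing at least `a u³` per step while above `2` is at most `2` after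
`1 / a` steps. -/
lemma le_two_or_of_cubic_decay {a : ℝ} (ha : 0 ≤ a) {T : ℕ} (u : ℕ → ℝ)
    (hu0 : ∀ t ≤ T, 0 ≤ u t) (hmono : ∀ t < T, u (t + 1) ≤ u t)
    (hstep : ∀ t < T, 2 ≤ u t → u (t + 1) ≤ u t - a * u t ^ 3) (t : ℕ) (ht : t ≤ T) :
    u t ≤ 2 ∨ a * t * u t ^ 2 ≤ 1 := by
  induction t with
  | zero => right; simp
  | succ t ih =>
    have htT : t < T := ht
    by_cases h2 : u t ≤ 2
    · exact .inl ((hmono t htT).trans h2)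
    push Not at h2
    right
    have h1 := (ih htT.le).resolve_left h2.not_ge
    have h3 := hstep t htT h2.le
    have h0 := hu0 (t + 1) ht
    set v := u t
    set s := a * v ^ 2 with hs
    have hs0 : 0 ≤ s := by positivity
    have h4 : u (t + 1) ≤ v * (1 - s) := by rw [hs]; linarith
    have hs1 : s ≤ 1 := by
      by_contra! h
      nlinarith
    push_cast
    -- Discrete form of the fact that $u'\le-au^3$ makes $u^{-2}$ grow linearly; the last bound is
    -- $(1-s)(1-s^2)\le1$.
    calc a * (t + 1) * u (t + 1) ^ 2 ≤ a * (t + 1) * (v * (1 - s)) ^ 2 := by gcongr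
      _ = (a * t * v ^ 2 + s) * (1 - s) ^ 2 := by rw [hs]; ring
      _ ≤ (1 + s) * (1 - s) ^ 2 := by gcongr
      _ ≤ 1 := by nlinarith [mul_nonneg hs0 hs0, mul_nonneg hs0 (sub_nonneg.2 hs1)]

/-- Ultracontractive and exponential decay of the variance of a density transported by a sequence
of kernels charging the diagonal and the right neighbours, in terms of the rate
`b = δ / (2 c² (N + 1)²)`. -/
lemma variance_le_exp {N T : ℕ} {c δ : ℝ} (hc : 1 ≤ c) (hδ : 0 < δ)
    (P : ℕ → Matrix (Fin (N + 1)) (Fin (N + 1)) ℝ) (ν f : ℕ → Fin (N + 1) → ℝ)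
    (hP0 : ∀ t < T, ∀ x y, 0 ≤ P t x y) (hP1 : ∀ t < T, ∀ x, ∑ y, P t x y = 1)
    (hPd : ∀ t < T, ∀ x, δ ≤ P t x x) (hPs : ∀ t < T, ∀ i : Fin N, δ ≤ P t i.castSucc i.succ)
    (hν : ∀ t ≤ T, ∀ x, 1 / (c * (N + 1)) ≤ ν t x) (hsum : ∀ t ≤ T, ∑ x, ν t x = 1)
    (hstep : ∀ t < T, ∀ y, ∑ x, ν (t + 1) x * P t x y = ν t y)
    (hf0 : ∀ x, 0 ≤ f 0 x) (hf : ∑ x, ν 0 x * f 0 x = 1)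
    (hfs : ∀ t < T, f (t + 1) = P t *ᵥ f t)
    (s t : ℕ) (hst : s + t ≤ T) (hs : 64 ≤ δ / (2 * c ^ 2 * (N + 1) ^ 2) * s) :
    ∑ x, ν (s + t) x * (f (s + t) x - 1) ^ 2 ≤
      Real.exp (-(δ / (2 * c ^ 2 * (N + 1) ^ 2) * t)) := by
  set b := δ / (2 * c ^ 2 * ((N : ℝ) + 1) ^ 2) with hb
  have hL : (0 : ℝ) < (N : ℝ) + 1 := by positivity
  have hc0 : 0 < c := by linarith
  have hb0 : 0 < b := by positivity
  have hν0 : ∀ t ≤ T, ∀ x, 0 ≤ ν t x := fun t ht x => le_trans (by positivity) (hν t ht x)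
  have hfnn : ∀ t ≤ T, ∀ x, 0 ≤ f t x := by
    intro t
    induction t with
    | zero => exact fun _ => hf0
    | succ t ih =>
      intro ht x
      rw [hfs t ht]
      simp only [Matrix.mulVec, dotProduct]
      exact sum_nonneg fun y _ => mul_nonneg (hP0 t ht x y) (ih (Nat.le_of_succ_le ht) y)
  have hmean : ∀ t ≤ T, ∑ x, ν t x * f t x = 1 := by
    intro t
    induction t with
    | zero => exact fun _ => hf
    | succ t ih =>
      intro ht
      rw [← ih (Nat.le_of_succ_le ht), hfs t ht]
      simp only [← hstep t ht, Matrix.mulVec, dotProduct, mul_sum, sum_mul]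
      rw [sum_comm]
      simp only [mul_assoc]
  set u : ℕ → ℝ := fun t => ∑ x, ν t x * f t x ^ 2 with hu
  have hu0 : ∀ t ≤ T, 0 ≤ u t := fun t ht =>
    sum_nonneg fun x _ => mul_nonneg (hν0 t ht x) (sq_nonneg _)
  have hdiss : ∀ t < T, u (t + 1) + 1 / (c * (N + 1)) * (δ / 2) * pathEnergy (f t) ≤ u t := by
    intro t ht
    have := energy_dissipation hδ.le (by positivity) (P t) (ν t) (ν (t + 1)) (f t) (hP0 t ht)
      (hP1 t ht) (hPd t ht) (hPs t ht) (hν (t + 1) ht) (hstep t ht)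
    rwa [← hfs t ht] at this
  have hmono : ∀ t < T, u (t + 1) ≤ u t := fun t ht => by
    have := hdiss t ht
    have h2 : 0 ≤ 1 / (c * (N + 1)) * (δ / 2) * pathEnergy (f t) :=
      mul_nonneg (by positivity) (pathEnergy_nonneg _)
    linarith
  have hcubic : ∀ t < T, 2 ≤ u t → u (t + 1) ≤ u t - b / 64 * u t ^ 3 := by
    intro t ht h2
    have h1 := hdiss t ht
    have h3 := nash hc0 (ν t) (f t) (hν t ht.le) (hsum t ht.le) (hfnn t ht.le) (hmean t ht.le) h2
    have h4 : b / 64 * u t ^ 3 ≤ 1 / (c * (N + 1)) * (δ / 2) * pathEnergy (f t) := by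
      calc b / 64 * u t ^ 3 ≤ b / 64 * (64 * c * (N + 1) * pathEnergy (f t)) := by gcongr
        _ = _ := by rw [hb]; field_simp
    linarith
  have hgap : ∀ t < T, u (t + 1) - 1 ≤ (1 - b) * (u t - 1) := by
    intro t ht
    have h1 := hdiss t ht
    have h3 := poincare (ν t) (f t) (hν0 t ht.le) (hsum t ht.le) (hmean t ht.le)
    have hE := pathEnergy_nonneg (f t)
    have h4 : b * (u t - 1) ≤ 1 / (c * (N + 1)) * (δ / 2) * pathEnergy (f t) := by
      calc b * (u t - 1) ≤ b * (c * (N + 1) * pathEnergy (f t)) := by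
            gcongr
            refine h3.trans ?_
            gcongr
            nlinarith
        _ = _ := by rw [hb]; field_simp
    linarith
  have hvar : ∀ t ≤ T, ∑ x, ν t x * (f t x - 1) ^ 2 = u t - 1 := fun t ht => by
    have e : ∀ x, ν t x * (f t x - 1) ^ 2 = ν t x * f t x ^ 2 - 2 * (ν t x * f t x) + ν t x :=
      fun x => by ring
    simp only [e, sum_add_distrib, sum_sub_distrib, ← mul_sum, hsum t ht, hmean t ht, hu]
    ring
  have hu1 : ∀ t ≤ T, 1 ≤ u t := fun t ht => by
    have := hvar t ht
    have h2 : 0 ≤ ∑ x, ν t x * (f t x - 1) ^ 2 :=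
      sum_nonneg fun x _ => mul_nonneg (hν0 t ht x) (sq_nonneg _)
    linarith
  have hs2 : u s ≤ 2 := by
    have hsT : s ≤ T := by omega
    rcases le_two_or_of_cubic_decay (by positivity) u hu0 hmono hcubic s hsT with h | h
    · exact h
    -- The waiting time $64/b$ forces `u s ^ 2 ≤ 1`.
    · have h1 : 1 ≤ b / 64 * s := by linarith
      nlinarith [hu1 s hsT]
  rw [hvar _ hst]
  induction t with
  | zero => simpa using by linarith
  | succ t ih =>
    have h1 := ih (by omega)
    have h2 := hgap (s + t) (by omega)
    have h3 := hu1 (s + t) (by omega)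
    calc u (s + (t + 1)) - 1 ≤ (1 - b) * (u (s + t) - 1) := h2
      _ ≤ Real.exp (-b) * (u (s + t) - 1) := by
          have := Real.one_sub_le_exp_neg b
          gcongr
      _ ≤ Real.exp (-b) * Real.exp (-(b * t)) := by gcongr
      _ = _ := by rw [← Real.exp_add]; congr 1; push_cast; ring

/-- With $\delta=1/(4c^2)$ the relaxation time is $R=1/b=8c^4(N+1)^2$. It takes $64R$ steps to reach
$u\le2$ and $R(2+\log(1/\varepsilon))$ more to reach $\varepsilon/4$, since $2>\log4$. Hence
$528=66\cdot8$; the extra 1 pays for rounding up. -/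
lemma variance_le_of_le_time {N T : ℕ} {c ε : ℝ} (hc : 1 ≤ c) (hε : 0 < ε) (hε1 : ε < 1)
    (P : ℕ → Matrix (Fin (N + 1)) (Fin (N + 1)) ℝ) (ν f : ℕ → Fin (N + 1) → ℝ)
    (hP0 : ∀ t < T, ∀ x y, 0 ≤ P t x y) (hP1 : ∀ t < T, ∀ x, ∑ y, P t x y = 1)
    (hPd : ∀ t < T, ∀ x, 1 / (4 * c ^ 2) ≤ P t x x)
    (hPs : ∀ t < T, ∀ i : Fin N, 1 / (4 * c ^ 2) ≤ P t i.castSucc i.succ)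
    (hν : ∀ t ≤ T, ∀ x, 1 / (c * (N + 1)) ≤ ν t x) (hsum : ∀ t ≤ T, ∑ x, ν t x = 1)
    (hstep : ∀ t < T, ∀ y, ∑ x, ν (t + 1) x * P t x y = ν t y)
    (hf0 : ∀ x, 0 ≤ f 0 x) (hf : ∑ x, ν 0 x * f 0 x = 1)
    (hfs : ∀ t < T, f (t + 1) = P t *ᵥ f t)
    (hT : (528 * c ^ 4 + 1) * ((N : ℝ) + 1) ^ 2 * (1 + Real.log (1 / ε)) ≤ T) :
    ∑ x, ν T x * (f T x - 1) ^ 2 ≤ ε / 4 := by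
  have hc0 : 0 < c := by linarith
  set L := (N : ℝ) + 1 with hL
  have hL1 : 1 ≤ L := by simp [hL]
  set ℓ := Real.log (1 / ε) with hℓ
  have hℓ0 : 0 ≤ ℓ := Real.log_nonneg ((one_le_div hε).2 hε1.le)
  set R := 8 * c ^ 4 * L ^ 2 with hR
  have hR0 : 0 < R := by positivity
  have hb : 1 / (4 * c ^ 2) / (2 * c ^ 2 * L ^ 2) = 1 / R := by rw [hR]; field_simp; norm_num
  have hT2 : 66 * R + R * ℓ + 1 ≤ T := by
    have e : (528 * c ^ 4 + 1) * L ^ 2 * (1 + ℓ) = 66 * R + 66 * (R * ℓ) + L ^ 2 * (1 + ℓ) := by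
      rw [hR]; ring
    have h1 : 1 ≤ L ^ 2 := one_le_pow₀ hL1
    have := mul_nonneg hR0.le hℓ0
    nlinarith
  set s := ⌈64 * R⌉₊
  have hs1 : 64 * R ≤ s := Nat.le_ceil _
  have hs2 : (s : ℝ) < 64 * R + 1 := Nat.ceil_lt_add_one (by positivity)
  have hsT : s ≤ T := by
    have := mul_nonneg hR0.le hℓ0
    exact_mod_cast (show (s : ℝ) ≤ T by linarith)
  obtain ⟨t, rfl⟩ := Nat.exists_eq_add_of_le hsT
  push_cast at hT2
  have hmain := variance_le_exp hc (by positivity : 0 < 1 / (4 * c ^ 2)) P ν f hP0 hP1 hPd hPs hν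
    hsum hstep hf0 hf hfs s t le_rfl (by rw [hb, one_div_mul_eq_div, le_div_iff₀ hR0]; exact hs1)
  refine hmain.trans ?_
  rw [hb, one_div_mul_eq_div, ← Real.le_log_iff_exp_le (by positivity)]
  have h1 : 2 + ℓ ≤ t / R := by rw [le_div_iff₀ hR0]; linarith
  have h2 : Real.log (ε / 4) = -ℓ - 2 * Real.log 2 := by
    rw [Real.log_div hε.ne' (by norm_num), hℓ, one_div, Real.log_inv,
      show (4 : ℝ) = 2 ^ 2 by norm_num, Real.log_pow]
    push_cast; ring
  have := Real.log_two_lt_d9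
  linarith

/-! ### Forward and backward densities of the chain -/

section Transport

variable {N : ℕ} {K : ℕ → Matrix (Fin (N + 1)) (Fin (N + 1)) ℝ} {c : ℝ}

lemma entry_nonneg (hK : ∀ i, 1 ≤ i → K i ∈ bdClass N) (n : ℕ) (x y : Fin (N + 1)) :
    0 ≤ K (n + 1) x y :=
  (Matrix.mem_rowStochastic_iff_sum.mp (hK (n + 1) (by omega)).1).1 x y

lemma row_sum (hK : ∀ i, 1 ≤ i → K i ∈ bdClass N) (n : ℕ) (x : Fin (N + 1)) :
    ∑ y, K (n + 1) x y = 1 :=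
  (Matrix.mem_rowStochastic_iff_sum.mp (hK (n + 1) (by omega)).1).2 x

lemma quarter_le_entry (hK : ∀ i, 1 ≤ i → K i ∈ bdClass N) (n : ℕ) {x y : Fin (N + 1)}
    (h : |(x : ℤ) - (y : ℤ)| ≤ 1) : 1 / 4 ≤ K (n + 1) x y :=
  ((hK (n + 1) (by omega)).2.2.1 x y h).1

lemma uniform_vecMul_iter_succ (n : ℕ) (y : Fin (N + 1)) :
    (uniform (Fin (N + 1)) ᵥ* iter K (n + 1)) y =
      ∑ x, (uniform (Fin (N + 1)) ᵥ* iter K n) x * K (n + 1) x y := by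
  rw [iter, ← Matrix.vecMul_vecMul]
  rfl

lemma sum_uniform_vecMul_iter (hK : ∀ i, 1 ≤ i → K i ∈ bdClass N) (n : ℕ) :
    ∑ x, (uniform (Fin (N + 1)) ᵥ* iter K n) x = 1 := by
  induction n with
  | zero =>
    have : (N : ℝ) + 1 ≠ 0 := by positivity
    simp [iter, uniform, this]
  | succ n ih =>
    simp only [uniform_vecMul_iter_succ]
    rw [sum_comm]
    simp only [← mul_sum, row_sum hK, mul_one, ih]

lemma IsStable.uniform_bounds (hc : 1 ≤ c) (h : IsStable c K (uniform (Fin (N + 1)))) (n : ℕ)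
    (x : Fin (N + 1)) :
    1 / (c * (N + 1)) ≤ (uniform (Fin (N + 1)) ᵥ* iter K n) x ∧
      (uniform (Fin (N + 1)) ᵥ* iter K n) x ≤ c / (N + 1) := by
  have hc0 : 0 < c := by linarith
  have hL : (0 : ℝ) < (N : ℝ) + 1 := by positivity
  obtain ⟨h1, h2⟩ := h.2 n x
  have e : uniform (Fin (N + 1)) x = 1 / ((N : ℝ) + 1) := by simp [uniform]
  rw [e, div_div_eq_mul_div, div_one] at h1 h2
  constructor
  · rw [div_le_iff₀ (by positivity)]
    calc 1 = c⁻¹ * c := (inv_mul_cancel₀ hc0.ne').symm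
      _ ≤ (uniform (Fin (N + 1)) ᵥ* iter K n) x * (N + 1) * c := by gcongr
      _ = _ := by ring
  · rwa [le_div_iff₀ hL]

/-- Variance bound for the densities `K_{0,T}(x, ·) / μ_T`. -/
lemma variance_forward_le (hc : 1 ≤ c) (hK : ∀ i, 1 ≤ i → K i ∈ bdClass N)
    (hst : IsStable c K (uniform (Fin (N + 1)))) {ε : ℝ} (hε : 0 < ε) (hε1 : ε < 1) {T : ℕ}
    (hT : (528 * c ^ 4 + 1) * ((N : ℝ) + 1) ^ 2 * (1 + Real.log (1 / ε)) ≤ T)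
    (x : Fin (N + 1)) :
    ∑ w, (uniform (Fin (N + 1)) ᵥ* iter K T) w *
      (iter K T x w / (uniform (Fin (N + 1)) ᵥ* iter K T) w - 1) ^ 2 ≤ ε / 4 := by
  have hc0 : 0 < c := by linarith
  have hL : (0 : ℝ) < (N : ℝ) + 1 := by positivity
  set μ : ℕ → Fin (N + 1) → ℝ := fun n => uniform (Fin (N + 1)) ᵥ* iter K n with hμ
  have hlow : ∀ n x, 1 / (c * (N + 1)) ≤ μ n x := fun n x => (hst.uniform_bounds hc n x).1
  have hup : ∀ n x, μ n x ≤ c / (N + 1) := fun n x => (hst.uniform_bounds hc n x).2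
  have hpos : ∀ n x, 0 < μ n x := fun n x => lt_of_lt_of_le (by positivity) (hlow n x)
  have hadj : ∀ n {y w : Fin (N + 1)}, |(w : ℤ) - (y : ℤ)| ≤ 1 →
      1 / (4 * c ^ 2) ≤ μ n w * K (n + 1) w y / μ (n + 1) y := by
    intro n y w h
    rw [le_div_iff₀ (hpos _ _)]
    calc 1 / (4 * c ^ 2) * μ (n + 1) y ≤ 1 / (4 * c ^ 2) * (c / (N + 1)) := by
          gcongr
          exact hup _ _
      _ = 1 / (c * (N + 1)) * (1 / 4) := by field_simp
      _ ≤ μ n w * K (n + 1) w y :=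
          mul_le_mul (hlow n w) (quarter_le_entry hK n h) (by norm_num) (hpos n w).le
  -- These kernels are the time reversals of `K (t + 1)`, sending `μ (t + 1)` back to `μ t`; the
  -- ratio of the two measures costs the factor $c^2$ in `hadj`.
  refine variance_le_of_le_time hc hε hε1
    (fun t => Matrix.of fun y w => μ t w * K (t + 1) w y / μ (t + 1) y) μ
    (fun t w => iter K t x w / μ t w) ?_ ?_ ?_ ?_ (fun t _ => hlow t)
    (fun t _ => sum_uniform_vecMul_iter hK t) ?_ ?_ ?_ ?_ hT
  · intro t _ y w
    exact div_nonneg (mul_nonneg (hpos t w).le (entry_nonneg hK t w y)) (hpos _ y).le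
  · intro t _ y
    simp only [Matrix.of_apply]
    rw [← sum_div, div_eq_one_iff_eq (hpos _ y).ne', hμ]
    exact (uniform_vecMul_iter_succ t y).symm
  · intro t _ y
    exact hadj t (by simp)
  · intro t _ i
    exact hadj t (by simp)
  · intro t _ w
    have : ∀ y, μ (t + 1) y * (μ t w * K (t + 1) w y / μ (t + 1) y) = μ t w * K (t + 1) w y :=
      fun y => mul_div_cancel₀ _ (hpos _ y).ne'
    simp only [Matrix.of_apply, this, ← mul_sum, row_sum hK, mul_one]
  · intro w
    refine div_nonneg ?_ (hpos 0 w).le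
    simp only [iter, Matrix.one_apply]
    split_ifs <;> norm_num
  · have : ∀ w, μ 0 w * (iter K 0 x w / μ 0 w) = iter K 0 x w :=
      fun w => mul_div_cancel₀ _ (hpos _ w).ne'
    simp only [this]
    simp [iter, Matrix.one_apply]
  · intro t _
    ext y
    have : ∀ w, μ t w * K (t + 1) w y / μ (t + 1) y * (iter K t x w / μ t w) =
        iter K t x w * K (t + 1) w y / μ (t + 1) y := fun w => by
      have h1 := (hpos t w).ne'
      have h2 := (hpos (t + 1) y).ne'
      field_simp
    simp only [Matrix.mulVec, dotProduct, Matrix.of_apply, this, ← sum_div, iter,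
      Matrix.mul_apply]

/-- The densities `K_{n-t,n}(·, z) / μ_n(z)`, started at a positive weight `m = μ_n(z)`. -/
noncomputable def backward (K : ℕ → Matrix (Fin (N + 1)) (Fin (N + 1)) ℝ) (n : ℕ) (z : Fin (N + 1)) (m : ℝ) :
    ℕ → Fin (N + 1) → ℝ
  | 0 => Pi.single z m⁻¹
  | t + 1 => K (n - t) *ᵥ backward K n z m t

lemma iter_mulVec_backward (n : ℕ) (z : Fin (N + 1)) (m : ℝ) (t : ℕ) (ht : t ≤ n) :
    iter K (n - t) *ᵥ backward K n z m t = fun x => iter K n x z / m := by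
  induction t with
  | zero =>
    ext x
    simp [backward, div_eq_mul_inv]
  | succ t ih =>
    rw [← ih (by omega), backward, Matrix.mulVec_mulVec]
    have : n - t = n - (t + 1) + 1 := by omega
    rw [this, iter]

lemma variance_backward_le (hc : 1 ≤ c) (hK : ∀ i, 1 ≤ i → K i ∈ bdClass N)
    (hst : IsStable c K (uniform (Fin (N + 1)))) {ε : ℝ} (hε : 0 < ε) (hε1 : ε < 1) {n T : ℕ}
    (hn : T ≤ n) (hT : (528 * c ^ 4 + 1) * ((N : ℝ) + 1) ^ 2 * (1 + Real.log (1 / ε)) ≤ T)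
    (z : Fin (N + 1)) :
    ∑ w, (uniform (Fin (N + 1)) ᵥ* iter K (n - T)) w *
      (backward K n z ((uniform (Fin (N + 1)) ᵥ* iter K n) z) T w - 1) ^ 2 ≤ ε / 4 := by
  have hc0 : 0 < c := by linarith
  have hlow := fun n x => (hst.uniform_bounds hc n x).1
  have hpos : ∀ n x, 0 < (uniform (Fin (N + 1)) ᵥ* iter K n) x :=
    fun n x => lt_of_lt_of_le (by positivity) (hlow n x)
  have hq : 1 / (4 * c ^ 2) ≤ 1 / 4 := by
    rw [div_le_div_iff₀ (by positivity) (by norm_num)]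
    nlinarith
  -- No truncation occurs, as `t < T ≤ n`: `K (n - t)` carries the measure at time `n - (t + 1)` to
  -- that at time `n - t`.
  have hidx : ∀ t < T, n - t = n - (t + 1) + 1 := fun t ht => by omega
  refine variance_le_of_le_time hc hε hε1 (fun t => K (n - t))
    (fun t => uniform (Fin (N + 1)) ᵥ* iter K (n - t)) (backward K n z _) ?_ ?_ ?_ ?_
    (fun t _ => hlow _) (fun t _ => sum_uniform_vecMul_iter hK _) ?_ ?_ ?_ (fun _ _ => rfl) hT
  · intro t ht x y
    simp only [hidx t ht]
    exact entry_nonneg hK _ x y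
  · intro t ht x
    simp only [hidx t ht]
    exact row_sum hK _ x
  · intro t ht x
    simp only [hidx t ht]
    exact hq.trans (quarter_le_entry hK _ (by simp))
  · intro t ht i
    simp only [hidx t ht]
    exact hq.trans (quarter_le_entry hK _ (by simp))
  · intro t ht y
    simp only [hidx t ht]
    exact (uniform_vecMul_iter_succ _ y).symm
  · intro x
    simp only [backward, Pi.single_apply]
    split_ifs
    · exact (inv_pos.2 (hpos n z)).le
    · exact le_rfl
  · simp [backward, Pi.single_apply, (hpos n z).ne']

/-- The forward and backward densities at time `T` both have mean 1 under $\mu_T$, so the deviation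
is their covariance, bounded by half the sum of their variances. -/
lemma abs_iter_div_sub_one_le (hc : 1 ≤ c) (hK : ∀ i, 1 ≤ i → K i ∈ bdClass N)
    (hst : IsStable c K (uniform (Fin (N + 1)))) {ε : ℝ} (hε : 0 < ε) (hε1 : ε < 1) {T : ℕ}
    (hT : (528 * c ^ 4 + 1) * ((N : ℝ) + 1) ^ 2 * (1 + Real.log (1 / ε)) ≤ T)
    (x z : Fin (N + 1)) :
    |iter K (T + T) x z / (uniform (Fin (N + 1)) ᵥ* iter K (T + T)) z - 1| ≤ ε / 4 := by
  have hc0 : 0 < c := by linarith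
  have hpos : ∀ n x, 0 < (uniform (Fin (N + 1)) ᵥ* iter K n) x :=
    fun n x => lt_of_lt_of_le (by positivity) (hst.uniform_bounds hc n x).1
  have h1 := variance_forward_le hc hK hst hε hε1 hT x
  have h2 := variance_backward_le hc hK hst hε hε1 (Nat.le_add_right T T) hT z
  have h3 := congrFun (iter_mulVec_backward (K := K) (T + T) z
    ((uniform (Fin (N + 1)) ᵥ* iter K (T + T)) z) T (Nat.le_add_right T T)) x
  have h4 : ∑ w, (uniform (Fin (N + 1)) ᵥ* iter K T) w *
      backward K (T + T) z ((uniform (Fin (N + 1)) ᵥ* iter K (T + T)) z) T w = 1 := by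
    have e : uniform (Fin (N + 1)) ⬝ᵥ (iter K (T + T - T) *ᵥ backward K (T + T) z
        ((uniform (Fin (N + 1)) ᵥ* iter K (T + T)) z) T) = 1 := by
      rw [iter_mulVec_backward _ _ _ _ (Nat.le_add_right T T)]
      simp only [dotProduct, ← mul_div_assoc, ← sum_div]
      exact div_self (hpos (T + T) z).ne'
    rw [Matrix.dotProduct_mulVec, Nat.add_sub_cancel] at e
    exact e
  have h5 : ∑ w, iter K T x w = 1 := by
    clear * - hK
    induction T with
    | zero => simp [iter, Matrix.one_apply]
    | succ n ih =>
      simp only [iter, Matrix.mul_apply]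
      rw [sum_comm]
      simp only [← mul_sum, row_sum hK, mul_one, ih]
  have h6 := sum_uniform_vecMul_iter hK T
  rw [Nat.add_sub_cancel] at h2 h3
  simp only [Matrix.mulVec, dotProduct] at h3
  rw [← h3]
  have hm := hpos T
  generalize (uniform (Fin (N + 1)) ᵥ* iter K T) = μ at *
  generalize backward K (T + T) z ((uniform (Fin (N + 1)) ᵥ* iter K (T + T)) z) T = g at *
  have h7 : ∑ w, iter K T x w * g w - 1 = ∑ w, μ w * ((iter K T x w / μ w - 1) * (g w - 1)) := by
    have e : ∀ w, μ w * ((iter K T x w / μ w - 1) * (g w - 1)) =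
        iter K T x w * g w - iter K T x w - μ w * g w + μ w := fun w => by
      have := (hm w).ne'
      field_simp
      ring
    simp only [e, sum_add_distrib, sum_sub_distrib, h4, h5, h6]
    ring
  rw [h7]
  calc |∑ w, μ w * ((iter K T x w / μ w - 1) * (g w - 1))|
      ≤ ∑ w, |μ w * ((iter K T x w / μ w - 1) * (g w - 1))| := abs_sum_le_sum_abs _ _
    _ ≤ ∑ w, (μ w * (iter K T x w / μ w - 1) ^ 2 / 2 + μ w * (g w - 1) ^ 2 / 2) := by
        refine sum_le_sum fun w _ => ?_
        rw [abs_mul, abs_of_pos (hm w), abs_mul]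
        have := two_mul_le_add_sq |iter K T x w / μ w - 1| |g w - 1|
        rw [sq_abs, sq_abs] at this
        nlinarith [mul_le_mul_of_nonneg_left this (hm w).le]
    _ ≤ ε / 4 := by
        rw [sum_add_distrib, ← sum_div, ← sum_div]
        linarith

end Transport

/-! ### Conclusion -/

/-- The numerators differ by at most $\varepsilon/2$ and the denominator is at least $3/4$; the
bound $2\varepsilon/3$ keeps the inequality strict. -/
lemma abs_ratio_sub_one_le {a b m ε : ℝ} (hm : 0 < m) (hε : 0 < ε) (hε1 : ε < 1)
    (ha : |a / m - 1| ≤ ε / 4) (hb : |b / m - 1| ≤ ε / 4) :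
    (ratio a b - 1).abs ≤ ENNReal.ofReal (2 * ε / 3) := by
  obtain ⟨a1, a2⟩ := abs_le.mp ha
  obtain ⟨b1, b2⟩ := abs_le.mp hb
  have hbm : 3 / 4 ≤ b / m := by linarith
  have hb0 : 0 < b := (div_pos_iff_of_pos_right hm).mp (by linarith)
  have e : a / b = (a / m) / (b / m) := by field_simp
  have h : |a / b - 1| ≤ 2 * ε / 3 := by
    rw [e, div_sub_one (by linarith), abs_div, abs_of_pos (by linarith : 0 < b / m),
      div_le_iff₀ (by linarith), abs_le]
    constructor <;> nlinarith
  rw [ratio, if_neg hb0.ne', ← EReal.coe_one, ← EReal.coe_sub, EReal.abs_def]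
  exact ENNReal.ofReal_le_ofReal h

/-- On one point the only entry would be 1, above the cap 3/4. This allows $N^2$ instead of
$(N+1)^2$ in the theorem. -/
lemma bdClass_zero : bdClass 0 = ∅ := by
  ext Q
  simp only [Set.mem_empty_iff_false, iff_false]
  rintro ⟨h, -, h2, -⟩
  have h1 := (Matrix.mem_rowStochastic_iff_sum.mp h).2 0
  have h3 := (h2 0 0 (by simp)).2
  simp only [Nat.reduceAdd, Finset.univ_unique, sum_singleton, Fin.default_eq_zero] at h1
  norm_num [h1] at h3

end Merging

theorem theorem1p1 (c : ℝ) (hc : 1 ≤ c) :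
    ∃ A : ℝ, 0 < A ∧
      ∀ (N : ℕ) (K : ℕ → Matrix (Fin (N + 1)) (Fin (N + 1)) ℝ),
        (∀ i, 1 ≤ i → K i ∈ Merging.bdClass N) →
        Merging.IsStable c K (Merging.uniform (Fin (N + 1))) →
        ∀ ε : ℝ, 0 < ε → ε < 1 →
          (Merging.relSupMergingTime K ε : ℝ≥0∞) ≤
            ENNReal.ofReal (A * (N : ℝ) ^ 2 * (1 + Real.posLog (1 / ε))) := by
  -- $16=2\cdot2\cdot4$: two halves of length `T`, $T\le S+1\le2S$, and $(N+1)^2\le4N^2$.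
  refine ⟨16 * (528 * c ^ 4 + 1), by positivity, fun N K hK hst ε hε hε1 => ?_⟩
  have hN : 1 ≤ N := by
    by_contra! h
    obtain rfl : N = 0 := by omega
    have := hK 1 le_rfl
    simp [Merging.bdClass_zero] at this
  have hN' : (1 : ℝ) ≤ N := by exact_mod_cast hN
  have hℓ : 0 ≤ Real.log (1 / ε) := Real.log_nonneg ((one_le_div hε).2 hε1.le)
  have hpl : Real.posLog (1 / ε) = Real.log (1 / ε) := max_eq_right hℓ
  set S := (528 * c ^ 4 + 1) * ((N : ℝ) + 1) ^ 2 * (1 + Real.log (1 / ε)) with hS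
  set T := ⌈S⌉₊
  have hS1 : 1 ≤ S := by
    have h1 : 1 ≤ 528 * c ^ 4 + 1 := le_add_of_nonneg_left (by positivity)
    have h2 : 1 ≤ ((N : ℝ) + 1) ^ 2 := one_le_pow₀ (by linarith)
    exact one_le_mul_of_one_le_of_one_le (one_le_mul_of_one_le_of_one_le h1 h2) (by linarith)
  have hT1 : S ≤ T := Nat.le_ceil S
  have hT2 : (T : ℝ) < S + 1 := Nat.ceil_lt_add_one (by linarith)
  have hrel : Merging.relSup K (T + T) < ENNReal.ofReal ε := by
    refine lt_of_le_of_lt (iSup_le fun x => iSup_le fun y => iSup_le fun z => ?_)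
      ((ENNReal.ofReal_lt_ofReal_iff hε).2 (by linarith : 2 * ε / 3 < ε))
    have hm : 0 < (Merging.uniform (Fin (N + 1)) ᵥ* Merging.iter K (T + T)) z :=
      lt_of_lt_of_le (by positivity) (hst.uniform_bounds hc (T + T) z).1
    exact Merging.abs_ratio_sub_one_le hm hε hε1
      (Merging.abs_iter_div_sub_one_le hc hK hst hε hε1 hT1 x z)
      (Merging.abs_iter_div_sub_one_le hc hK hst hε hε1 hT1 y z)
  have hle : Merging.relSupMergingTime K ε ≤ ((T + T : ℕ) : ℕ∞) := iInf₂_le (T + T) hrel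
  have hle' : (Merging.relSupMergingTime K ε : ℝ≥0∞) ≤ ((T + T : ℕ) : ℝ≥0∞) := by
    exact_mod_cast (ENat.toENNReal_le.2 hle)
  refine hle'.trans ?_
  rw [← ENNReal.ofReal_natCast, hpl]
  refine ENNReal.ofReal_le_ofReal ?_
  have hb : S ≤ (528 * c ^ 4 + 1) * (4 * (N : ℝ) ^ 2) * (1 + Real.log (1 / ε)) := by
    rw [hS]
    gcongr
    nlinarith
  push_cast
  linarith
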